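/- Let $\mathbb T^d=\mathbb R^d/\mathbb Z^d$ with its flat metric $d(\cdot,\cdot)$, let $\omega\in\mathbb T^d$ be totally irrational (that is, $1,\omega_1,\dots,\omega_d$ are rationally independent), let $X\subseteq\mathbb R$ be an interval with $[0,1]\subseteq X$, and let $f:\mathbb T^d\times X\to\mathbb T^d\times X$, $f(\theta,x)=(\theta+\omega,f_\theta(x))$, be a $\mathcal C^2$ map with monotone fibre maps $f_\theta$. Write $f^n_\theta(x)$ for the second coordinate of $f^n(\theta,x)$. Assume that $f$ belongs to the class $\mathcal V$, i.e. that for all $\theta\in\mathbb T^d$ $$f_\theta(0)\le 0,\quad f_\theta(1)\le 1,\quad f_\theta'(x)>0\ \text{ and }\ f_\theta''(x)<0\quad (x\in[0,1]),$$ and that there are: numbers $0<e<c<1$, with $E=[0,e]$ and $C=[c,1]$; a closed convex set $\mathcal I_0\subseteq\mathbb T^d$; real numbers $\alpha>1$, $p\ge\sqrt2$, $S>0$, $c_0>0$; integers $K_0\ge1$, $\kappa\ge 2$, with $K_n=K_0\kappa^n$, $b_0=1$, $b_{n+1}=(1-1/K_n)b_n$ and $b=\lim_n b_n>\sqrt{(p^2+1)/(p^2+2)}$;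 and integers $M_0\ge2$ and $M_{n+1}\in[K_nM_n,\,2K_nM_n-2]$ for $n\ge0$, with $M_{-1}=0$, such that the following three groups of conditions hold. 1. For all $\theta,\theta'\in\mathbb T^d$: - $f_\theta(x)\in C$ for $x\in[e,1]$, if $\theta\notin\mathcal I_0$; - $\alpha^{-p}|x-x'|\le|f_\theta(x)-f_\theta(x')|\le\alpha^p|x-x'|$ for $x,x'\in X$; - $|f_\theta(x)-f_{\theta'}(x)|\le S\,d(\theta,\theta')$ for $x\in X$; - $|f_\theta(x)-f_\theta(x')|\le\alpha^{-2/p}|x-x'|$ for $x,x'\in C$; - $|f_\theta(x)-f_\theta(x')|\ge\alpha^{2/p}|x-x'|$ for $x,x'\in E$. 2. Let $\varepsilon_n=c_0\alpha^{-M_{n-1}b/(2p)}$ for $n\ge0$. Define recursively $$\mathcal I_{n+1}=\pi_{\mathbb T^d}\Big(f^{M_n-1}\big((\mathcal I_n-(M_n-1)\omega)\times C\big)\cap f^{-(M_n+1)}\big((\mathcal I_n+(M_n+1)\omega)\times E\big)\Big),$$ and let $\mathcal V_n=\bigcup_{j=0}^n\bigcup_{l=1}^{M_j+1}(\mathcal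 I_j+l\omega)$, $\mathcal W_n=\bigcup_{j=0}^n\bigcup_{l=-(M_j-1)}^0(\mathcal I_j+l\omega)$ and $\mathcal V_{-1}=\mathcal W_{-1}=\emptyset$. Then for every $j\ge0$: $\mathcal I_j\ne\emptyset$, $$d\Big(\mathcal I_j,\bigcup_{k=1}^{2K_jM_j}(\mathcal I_j+k\omega)\Big)>\varepsilon_j\quad\text{and}\quad\big((\mathcal I_j-(M_j-1)\omega)\cup(\mathcal I_j+(M_j+1)\omega)\big)\cap(\mathcal V_{j-1}\cup\mathcal W_{j-1})=\emptyset .$$ 3. For every $n\ge1$, the diameter of $\mathcal I_n$ is smaller than $\varepsilon_n$. Let $\phi_n^+(\theta)=f^n_{\theta-n\omega}(1)$ be the $n$-th iterated upper boundary line, and for $j,n\ge1$ let $$\Omega_j^n=\mathbb T^d\setminus\bigcup_{k=j}^\infty\ \bigcup_{l=M_{k-1}}^{\min\{n,2K_kM_k\}}(\mathcal I_k+l\omega).$$ Then there are $\lambda>0$ and $C'>0$ such that the following holds for all sufficiently large $j$. (i) If $n>2K_{j-1}M_{j-1}-M_{j-1}-1$ and $\theta\in\Omega_j^n$, then $|\phi_n^+(\theta)-\phi_{n-1}^+(\theta)|\le\alpha^{-\lambda(n-1)}$.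 (ii) There is a number $L_j\le\varepsilon_j^{-C'K_{j-1}}$ such that, for all $n\ge1$ and all $\theta,\theta'\in\Omega_j^n$, $|\phi_n^+(\theta)-\phi_n^+(\theta')|\le L_j\,d(\theta,\theta')$. -/

import Mathlib

open Filter Topology

noncomputable section

namespace QpfSNA

/-- The torus `𝕋^d = ℝ^d / ℤ^d` with its flat (Euclidean) metric
`d(θ, θ') = (∑ i, ‖θ i - θ' i‖ ^ 2) ^ (1 / 2)`, where `‖·‖` is the distance to `0` in `ℝ / ℤ`. -/
abbrev Torus (d : ℕ) : Type := PiLp 2 (fun _ : Fin d => UnitAddCircle)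

/-- The canonical projection `ℝ^d → 𝕋^d`. -/
def Torus.proj {d : ℕ} (y : EuclideanSpace ℝ (Fin d)) : Torus d :=
  WithLp.toLp 2 (fun i => ((y i : ℝ) : UnitAddCircle))

/-- `ω` is totally irrational: no nontrivial integer combination of its coordinates vanishes
modulo `1`, i.e. `1, ω_1, …, ω_d` are rationally independent. -/
def TotallyIrrational {d : ℕ} (ω : Torus d) : Prop :=
  ∀ k : Fin d → ℤ, k ≠ 0 → ∑ i, k i • ω i ≠ 0

/-- The translate `A + l ω`. -/
def shift {d : ℕ} (ω : Torus d) (l : ℤ) (A : Set (Torus d)) : Set (Torus d) :=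
  (fun θ => θ + l • ω) '' A

/-- A closed convex subset of the torus: a closed set which is the projection of a convex
subset of `ℝ^d`. -/
def IsClosedConvex {d : ℕ} (A : Set (Torus d)) : Prop :=
  IsClosed A ∧ ∃ K : Set (EuclideanSpace ℝ (Fin d)), Convex ℝ K ∧ Torus.proj '' K = A

/-- The distance of two (nonempty) sets, `inf {d(a, b) | a ∈ A, b ∈ B}`. -/
def setDist {d : ℕ} (A B : Set (Torus d)) : ℝ :=
  sInf {r : ℝ | ∃ a ∈ A, ∃ b ∈ B, r = dist a b}

/-- The skew product `(θ, x) ↦ (θ + ω, f_θ(x))`. The fibre maps are written as functions on `ℝ`,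
but only their restrictions to the interval `X` of `IsForcedMap` are ever used. -/
def skew {d : ℕ} (ω : Torus d) (f : Torus d → ℝ → ℝ) (z : Torus d × ℝ) : Torus d × ℝ :=
  (z.1 + ω, f z.1 z.2)

/-- The class `𝓕_ω`: quasiperiodically forced monotone interval maps of class `C²` on `𝕋^d × X`,
where `X ⊆ ℝ` is a (possibly non-compact) interval containing `[0, 1]`. -/
structure IsForcedMap {d : ℕ} (ω : Torus d) (X : Set ℝ) (f : Torus d → ℝ → ℝ) : Prop where
  irrational : TotallyIrrational ω
  interval : X.OrdConnected
  unit_subset : Set.Icc (0 : ℝ) 1 ⊆ X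
  mapsTo : ∀ θ, Set.MapsTo (f θ) X X
  monotone : ∀ θ, MonotoneOn (f θ) X
  contDiff : ContDiffOn ℝ 2
    (fun z : EuclideanSpace ℝ (Fin d) × ℝ => f (Torus.proj z.1) z.2) (Set.univ ×ˢ X)

/-- `f_θ(0) ≤ 0`, `f_θ(1) ≤ 1`, and `f_θ' > 0`, `f_θ'' < 0` on `[0, 1]`. The derivatives are taken
within `X` (one-sided at end points of `X`). -/
structure IsConcaveIncreasing {d : ℕ} (X : Set ℝ) (f : Torus d → ℝ → ℝ) : Prop where
  map_zero_le : ∀ θ, f θ 0 ≤ 0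
  map_one_le : ∀ θ, f θ 1 ≤ 1
  deriv_pos : ∀ θ, ∀ x ∈ Set.Icc (0 : ℝ) 1, 0 < derivWithin (f θ) X x
  deriv2_neg : ∀ θ, ∀ x ∈ Set.Icc (0 : ℝ) 1, iteratedDerivWithin 2 (f θ) X x < 0

/-- `K_n = K_0 κ^n`. -/
def Kseq (K₀ κ : ℕ) (n : ℕ) : ℕ := K₀ * κ ^ n

/-- `b_0 = 1`, `b_{n+1} = (1 - 1 / K_n) b_n`. -/
def bseq (K₀ κ : ℕ) : ℕ → ℝ
  | 0 => 1
  | n + 1 => (1 - 1 / (Kseq K₀ κ n : ℝ)) * bseq K₀ κ n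

/-- An admissible choice of the constants: the end points of `C = [c, 1]` and `E = [0, e]`, the
first critical region `I₀`, the numbers `α, p, S, c₀`, the integers `K₀, κ` and the sequence
`M_n`; `b` is the limit of the sequence `b_n`. -/
structure Constants (d : ℕ) where
  c : ℝ
  e : ℝ
  I₀ : Set (Torus d)
  α : ℝ
  p : ℝ
  S : ℝ
  c₀ : ℝ
  K₀ : ℕ
  κ : ℕ
  M : ℕ → ℕ
  b : ℝ
  e_pos : 0 < e
  e_lt_c : e < c
  c_lt_one : c < 1
  I₀_convex : IsClosedConvex I₀
  one_lt_α : 1 < α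
  sqrt_two_le_p : √2 ≤ p
  S_pos : 0 < S
  c₀_pos : 0 < c₀
  K₀_pos : 1 ≤ K₀
  two_le_κ : 2 ≤ κ
  tendsto_b : Tendsto (bseq K₀ κ) atTop (𝓝 b)
  b_large : √((p ^ 2 + 1) / (p ^ 2 + 2)) < b
  two_le_M_zero : 2 ≤ M 0
  le_M : ∀ n, Kseq K₀ κ n * M n ≤ M (n + 1)
  M_le : ∀ n, M (n + 1) + 2 ≤ 2 * Kseq K₀ κ n * M n

namespace Constants

variable {d : ℕ} (P : Constants d)

/-- The contracting interval `C = [c, 1]`. -/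
def C : Set ℝ := Set.Icc P.c 1

/-- The expanding interval `E = [0, e]`. -/
def E : Set ℝ := Set.Icc 0 P.e

/-- `K_n = K_0 κ^n`. -/
def K (n : ℕ) : ℕ := Kseq P.K₀ P.κ n

/-- `Mpred n` is `M_{n-1}`, where `M_{-1} = 0`. -/
def Mpred : ℕ → ℕ
  | 0 => 0
  | n + 1 => P.M n

/-- `ε_n = c₀ α^{- M_{n-1} b / (2 p)}`. -/
def eps (n : ℕ) : ℝ := P.c₀ * P.α ^ (-((P.Mpred n : ℝ) * P.b / (2 * P.p)))

end Constants

section Regions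

variable {d : ℕ} (ω : Torus d) (f : Torus d → ℝ → ℝ) (P : Constants d)

/-- The critical regions: `I_{n+1}` is the projection to `𝕋^d` of
`f^{M_n - 1}(A_n) ∩ f^{-(M_n + 1)}(B_n)`, where `A_n = (I_n - (M_n - 1) ω) × C` and
`B_n = (I_n + (M_n + 1) ω) × E`. (Recall that `M_n ≥ 2`.) -/
def critRegion : ℕ → Set (Torus d)
  | 0 => P.I₀
  | n + 1 =>
    Prod.fst ''
      (((skew ω f)^[P.M n - 1] '' (shift ω (-((P.M n : ℤ) - 1)) (critRegion n) ×ˢ P.C)) ∩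
        ((skew ω f)^[P.M n + 1] ⁻¹' (shift ω ((P.M n : ℤ) + 1) (critRegion n) ×ˢ P.E)))

/-- `calVpred n` is `𝓥_{n-1} = ⋃_{j=0}^{n-1} ⋃_{l=1}^{M_j+1} (I_j + l ω)`, and `𝓥_{-1} = ∅`. -/
def calVpred (n : ℕ) : Set (Torus d) :=
  {θ | ∃ j : ℕ, j < n ∧ ∃ l : ℤ, 1 ≤ l ∧ l ≤ (P.M j : ℤ) + 1 ∧ θ ∈ shift ω l (critRegion ω f P j)}

/-- `calWpred n` is `𝓦_{n-1} = ⋃_{j=0}^{n-1} ⋃_{l=-(M_j-1)}^{0} (I_j + l ω)`, and `𝓦_{-1} = ∅`. -/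
def calWpred (n : ℕ) : Set (Torus d) :=
  {θ | ∃ j : ℕ, j < n ∧ ∃ l : ℤ, -((P.M j : ℤ) - 1) ≤ l ∧ l ≤ 0 ∧
    θ ∈ shift ω l (critRegion ω f P j)}

/-- `(𝓕1)_n`: for `j = 0, …, n`, `I_j ≠ ∅` and
`d(I_j, ⋃_{k=1}^{2 K_j M_j} (I_j + k ω)) > ε_j`. -/
def CondF1 (n : ℕ) : Prop :=
  ∀ j ≤ n, (critRegion ω f P j).Nonempty ∧
    P.eps j < setDist (critRegion ω f P j)
      {θ | ∃ k : ℕ, 1 ≤ k ∧ k ≤ 2 * P.K j * P.M j ∧ θ ∈ shift ω k (critRegion ω f P j)}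

/-- `(𝓕2)_n`: for `j = 0, …, n`, `I_j ≠ ∅` and
`((I_j - (M_j - 1) ω) ∪ (I_j + (M_j + 1) ω)) ∩ (𝓥_{j-1} ∪ 𝓦_{j-1}) = ∅`. -/
def CondF2 (n : ℕ) : Prop :=
  ∀ j ≤ n, (critRegion ω f P j).Nonempty ∧
    (shift ω (-((P.M j : ℤ) - 1)) (critRegion ω f P j) ∪
      shift ω ((P.M j : ℤ) + 1) (critRegion ω f P j)) ∩
      (calVpred ω f P j ∪ calWpred ω f P j) = ∅

/-- `(𝓔)_n`: the diameter of `I_n` is smaller than `ε_n`. -/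
def CondE (n : ℕ) : Prop := Metric.diam (critRegion ω f P n) < P.eps n

/-- The set `Ω_j^n = 𝕋^d ∖ ⋃_{k ≥ j} ⋃_{l = M_{k-1}}^{min {n, 2 K_k M_k}} (I_k + l ω)`. -/
def Omega (j n : ℕ) : Set (Torus d) :=
  {θ | ∃ k : ℕ, j ≤ k ∧ ∃ l : ℕ, P.Mpred k ≤ l ∧ l ≤ min n (2 * P.K k * P.M k) ∧
    θ ∈ shift ω l (critRegion ω f P k)}ᶜ

/-- The `n`-th iterated upper boundary line `φ_n^+(θ) = f_{θ - n ω}^n(1)`. -/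
def upperLine (n : ℕ) (θ : Torus d) : ℝ := ((skew ω f)^[n] (θ - n • ω, 1)).2

end Regions

/-- The explicit estimates relative to the constants `P`. -/
structure SatisfiesEstimates {d : ℕ} (X : Set ℝ) (f : Torus d → ℝ → ℝ) (P : Constants d) :
    Prop where
  mem_C : ∀ θ, θ ∉ P.I₀ → ∀ x ∈ Set.Icc P.e 1, f θ x ∈ P.C
  lower : ∀ θ, ∀ x ∈ X, ∀ x' ∈ X, P.α ^ (-P.p) * |x - x'| ≤ |f θ x - f θ x'|
  upper : ∀ θ, ∀ x ∈ X, ∀ x' ∈ X, |f θ x - f θ x'| ≤ P.α ^ P.p * |x - x'|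
  base : ∀ θ θ', ∀ x ∈ X, |f θ x - f θ' x| ≤ P.S * dist θ θ'
  contract : ∀ θ, ∀ x ∈ P.C, ∀ x' ∈ P.C, |f θ x - f θ x'| ≤ P.α ^ (-2 / P.p) * |x - x'|
  expand : ∀ θ, ∀ x ∈ P.E, ∀ x' ∈ P.E, P.α ^ (2 / P.p) * |x - x'| ≤ |f θ x - f θ x'|

/-- `f` belongs to the class `𝓥` (with rotation vector `ω` and fibre interval `X`), as witnessed
by the constants `P`; so `f ∈ 𝓥` means that this holds for some `P`. -/
structure MemV {d : ℕ} (ω : Torus d) (X : Set ℝ) (f : Torus d → ℝ → ℝ) (P : Constants d) :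
    Prop where
  forced : IsForcedMap ω X f
  concave : IsConcaveIncreasing X f
  estimates : SatisfiesEstimates X f P
  condF1 : ∀ n, 1 ≤ n → CondF1 ω f P n
  condF2 : ∀ n, 1 ≤ n → CondF2 ω f P n
  condE : ∀ n, 1 ≤ n → CondE ω f P n

end QpfSNA

end

/-! The orbit of `(θ, 1)` stays in `[0, 1]`. A fibre map contracts by `α ^ (-2 / p)` between points
of `C` and expands by at most `α ^ p` anywhere, so everything depends on how often the orbit is
below `c` (a bad time).

Every bad time lies within `M_i + 1` steps after a visit to some `I_i`
(`MemV.exists_visit_of_fibreIter_lt`). The proof combines the two non-recurrence conditions with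
nonnegativity of the upper lines, which in turn rests on Kronecker's theorem. Visits to `I_i` are
more than `2 K_i M_i` apart, so level `i` contributes a density of order `1 / K_i`. Window ends cost
`O(M_J)` for the levels `i ≤ J`; for `i > J`, membership in `Ω_{J+1}^n` rules out visits close to
time `n`, apart from the last `M_J` steps. Hence the bad density is at most `1 - b` on windows
ending at `n` of length at least `K_J M_J` (`MemV.eventually_card_badTimes_le`).

For (i), `φ_n` and `φ_{n-1}` are two ordered points moving over the same base orbit, and only the
lower one produces bad times. For (ii), a Gronwall estimate sums the base errors `S d(θ, θ')`
against products of rates; two orbits double the bad density, and the bound on `b` still leaves a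
contraction. Windows shorter than `K_J M_J` cost a factor `α ^ (O(K_J M_J))`, which is a power `ε_j
^ (-C' K_{j-1})` with `j = J + 1`. -/

noncomputable section

namespace QpfSNA

/-! ### Density of orbits of totally irrational rotations. -/

section Kronecker

open UnitAddTorus

variable {d : ℕ}

lemma mFourier_add_nsmul (k : Fin d → ℤ) (x w : UnitAddTorus (Fin d)) (n : ℕ) :
    mFourier k (x + n • w) = mFourier k x * mFourier k w ^ n := by
  simp only [mFourier, ContinuousMap.coe_mk, ← Finset.prod_pow, ← Finset.prod_mul_distrib]
  refine Finset.prod_congr rfl fun i _ => ?_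
  simp only [Pi.add_apply, Pi.smul_apply, fourier_apply, smul_add, AddCircle.toCircle_add,
    Circle.coe_mul, smul_comm (k i) n, AddCircle.toCircle_nsmul, Circle.coe_pow]

lemma mFourier_eq_one_iff (k : Fin d → ℤ) (w : UnitAddTorus (Fin d)) :
    mFourier k w = 1 ↔ ∑ i, k i • w i = 0 := by
  have h : mFourier k w = AddCircle.toCircle (T := 1) (∑ i, k i • w i) := by
    simp only [mFourier, ContinuousMap.coe_mk, fourier_apply]
    induction (Finset.univ : Finset (Fin d)) using Finset.induction_on with
    | empty => simp
    | insert a s ha ih =>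
      rw [Finset.prod_insert ha, Finset.sum_insert ha, AddCircle.toCircle_add, Circle.coe_mul, ih]
  rw [h, Circle.coe_eq_one, ← AddCircle.toCircle_zero (T := 1),
    (AddCircle.injective_toCircle one_ne_zero).eq_iff]

/-- Along an orbit of an irrational rotation, the Birkhoff averages of a continuous function are
asymptotically independent of the initial point. -/
lemma tendsto_average_sub (w : UnitAddTorus (Fin d))
    (hw : ∀ k : Fin d → ℤ, k ≠ 0 → ∑ i, k i • w i ≠ 0)
    (x y : UnitAddTorus (Fin d)) (g : C(UnitAddTorus (Fin d), ℂ)) :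
    Tendsto (fun N : ℕ => (N : ℂ)⁻¹ * ∑ n ∈ Finset.range N, (g (x + n • w) - g (y + n • w)))
      atTop (𝓝 0) := by
  set A : C(UnitAddTorus (Fin d), ℂ) → ℕ → ℂ := fun g N =>
    (N : ℂ)⁻¹ * ∑ n ∈ Finset.range N, (g (x + n • w) - g (y + n • w)) with hA
  -- Uniformity in `N` lets convergence pass from trigonometric polynomials to their closure.
  have hlip : ∀ g h : C(UnitAddTorus (Fin d), ℂ), ∀ N : ℕ, ‖A g N - A h N‖ ≤ 2 * ‖g - h‖ := by
    intro g h N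
    rcases Nat.eq_zero_or_pos N with rfl | hN
    · simp [hA]
    have hN' : (0 : ℝ) < N := by exact_mod_cast hN
    have h1 : ∀ z, ‖g z - h z‖ ≤ ‖g - h‖ := fun z => (g - h).norm_coe_le_norm z
    rw [hA]
    simp only
    rw [← mul_sub, ← Finset.sum_sub_distrib, norm_mul, norm_inv, Complex.norm_natCast,
      inv_mul_le_iff₀ hN']
    refine (norm_sum_le_of_le _ (f := fun n => _) (n := fun _ => 2 * ‖g - h‖)
      fun n _ => ?_).trans (by simp)
    calc _ = ‖(g (x + n • w) - h (x + n • w)) - (g (y + n • w) - h (y + n • w))‖ := by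
          congr 1; ring
      _ ≤ _ := (norm_sub_le _ _).trans (by linarith [h1 (x + n • w), h1 (y + n • w)])
  have hspan : ∀ g ∈ Submodule.span ℂ (Set.range (mFourier (d := Fin d))),
      Tendsto (A g) atTop (𝓝 0) := by
    intro g hg
    induction hg using Submodule.span_induction with
    | mem g hg =>
      obtain ⟨k, rfl⟩ := hg
      by_cases hk : k = 0
      · subst hk
        simp [hA, mFourier_zero]
      have hz : mFourier k w ≠ 1 := fun h => hw k hk ((mFourier_eq_one_iff k w).1 h)
      have hz1 : ‖mFourier k w‖ ≤ 1 := by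
        simpa [mFourier_norm] using (mFourier k).norm_coe_le_norm w
      -- For a nontrivial character the sum is geometric with ratio different from 1, hence bounded
      -- in `N`.
      have hAk : ∀ N, A (mFourier k) N = (N : ℂ)⁻¹ *
          ((mFourier k x - mFourier k y) * ((mFourier k w ^ N - 1) / (mFourier k w - 1))) := by
        intro N
        simp only [hA, mFourier_add_nsmul, ← sub_mul]
        rw [← Finset.mul_sum, geom_sum_eq hz]
      rw [funext hAk]
      refine Tendsto.zero_mul_isBoundedUnder_le ?_ ?_
      · exact tendsto_inv_atTop_nhds_zero_nat
      · refine isBoundedUnder_of ⟨‖mFourier k x - mFourier k y‖ * (2 / ‖mFourier k w - 1‖),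
          fun N => ?_⟩
        simp only [Function.comp, norm_mul, norm_div]
        gcongr
        refine (norm_sub_le _ _).trans ?_
        rw [norm_pow, norm_one]
        linarith [pow_le_one₀ (n := N) (norm_nonneg _) hz1]
    | zero => simp [hA]
    | add g h _ _ hg hh =>
      have : A (g + h) = fun N => A g N + A h N := by
        ext N
        simp only [hA, ContinuousMap.add_apply, ← mul_add, ← Finset.sum_add_distrib]
        congr 1
        exact Finset.sum_congr rfl fun _ _ => by ring
      rw [this]
      simpa using hg.add hh
    | smul c g _ hg =>
      have : A (c • g) = fun N => c * A g N := by
        ext N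
        simp only [hA, ContinuousMap.smul_apply, smul_eq_mul, ← mul_sub, ← Finset.mul_sum]
        ring
      rw [this]
      simpa using hg.const_mul c
  rw [Metric.tendsto_atTop]
  intro ε hε
  have hcl : g ∈ closure (Submodule.span ℂ (Set.range (mFourier (d := Fin d))) :
      Set C(UnitAddTorus (Fin d), ℂ)) := by
    have := span_mFourier_closure_eq_top (d := Fin d)
    rw [← Submodule.topologicalClosure_coe, this]
    trivial
  obtain ⟨h, hh, hgh⟩ := Metric.mem_closure_iff.1 hcl (ε / 4) (by positivity)
  obtain ⟨N₀, hN₀⟩ := Metric.tendsto_atTop.1 (hspan h hh) (ε / 4) (by positivity)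
  refine ⟨N₀, fun N hN => ?_⟩
  have h1 := hN₀ N hN
  rw [dist_zero_right] at h1 ⊢
  rw [dist_eq_norm] at hgh
  calc ‖A g N‖ = ‖(A g N - A h N) + A h N‖ := by rw [sub_add_cancel]
    _ ≤ _ := norm_add_le _ _
    _ < ε := by linarith [hlip g h N]

/-- Kronecker's theorem: forward orbits of irrational rotations are dense. -/
lemma exists_nsmul_add_mem (w : UnitAddTorus (Fin d))
    (hw : ∀ k : Fin d → ℤ, k ≠ 0 → ∑ i, k i • w i ≠ 0)
    {U : Set (UnitAddTorus (Fin d))} (hU : IsOpen U) (hne : U.Nonempty)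
    (x : UnitAddTorus (Fin d)) : ∃ n : ℕ, x + n • w ∈ U := by
  by_contra! hcon
  obtain ⟨u, hu⟩ := hne
  obtain ⟨g, hg0, hg1, hg⟩ := exists_continuous_zero_one_of_isClosed
    (hU.isClosed_compl) (isClosed_singleton (x := u))
    (Set.disjoint_singleton_right.2 fun h => h hu)
  have hgnn : ∀ z, 0 ≤ g z := fun z => (hg z).1
  -- By compactness finitely many translates of the bump `g` have sum at least `1 / 2` everywhere,
  -- so their averages cannot all tend to 0.
  have hcov : (⋃ t : UnitAddTorus (Fin d), {z | (1 / 2 : ℝ) < g (z + t)}) = Set.univ := by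
    rw [Set.eq_univ_iff_forall]
    intro z
    refine Set.mem_iUnion.2 ⟨u - z, ?_⟩
    have : g u = 1 := hg1 rfl
    simp [this]
    norm_num
  obtain ⟨s, hs⟩ := isCompact_univ.elim_finite_subcover
    (fun t : UnitAddTorus (Fin d) => {z | (1 / 2 : ℝ) < g (z + t)})
    (fun t => isOpen_lt continuous_const (by fun_prop)) hcov.ge
  have hlow : ∀ z, (1 / 2 : ℝ) ≤ ∑ t ∈ s, g (z + t) := by
    intro z
    obtain ⟨t, ht, hz⟩ := Set.mem_iUnion₂.1 (hs (Set.mem_univ z))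
    exact (le_of_lt hz).trans (Finset.single_le_sum (f := fun t => g (z + t))
      (fun i _ => hgnn _) ht)
  -- `g` vanishes along the orbit of `x`, and the limit does not depend on the initial point.
  have hlim : ∀ y, Tendsto (fun N : ℕ => (N : ℝ)⁻¹ * ∑ n ∈ Finset.range N, g (y + n • w))
      atTop (𝓝 0) := by
    intro y
    have h := tendsto_average_sub w hw y x ((ContinuousMap.mk _ Complex.continuous_ofReal).comp g)
    have h2 := (Complex.continuous_re.tendsto _).comp h
    refine (h2.congr fun N => ?_)
    have hz : ∀ n : ℕ, g (x + n • w) = 0 := fun n => hg0 (hcon n)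
    have : ((N : ℂ)⁻¹ * ∑ n ∈ Finset.range N, ((g (y + n • w) : ℝ) : ℂ)) =
        (((N : ℝ)⁻¹ * ∑ n ∈ Finset.range N, g (y + n • w) : ℝ) : ℂ) := by push_cast; rfl
    simp only [Function.comp, ContinuousMap.comp_apply, ContinuousMap.coe_mk, hz,
      Complex.ofReal_zero, sub_zero]
    rw [this, Complex.ofReal_re]
  have hsum := tendsto_finsetSum s fun t (_ : t ∈ s) => hlim t
  rw [Finset.sum_const_zero] at hsum
  have hev : ∀ᶠ N : ℕ in atTop, (1 / 2 : ℝ) ≤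
      ∑ t ∈ s, (N : ℝ)⁻¹ * ∑ n ∈ Finset.range N, g (t + n • w) := by
    filter_upwards [eventually_gt_atTop 0] with N hN
    have hN' : (0 : ℝ) < N := by exact_mod_cast hN
    rw [← Finset.mul_sum, Finset.sum_comm, ← div_eq_inv_mul, le_div_iff₀ hN']
    calc (1 / 2 : ℝ) * N = ∑ n ∈ Finset.range N, (1 / 2 : ℝ) := by simp; ring
      _ ≤ _ := Finset.sum_le_sum fun n _ => by simpa [add_comm] using hlow (n • w)
  have := ge_of_tendsto hsum hev
  norm_num at this

/-- Orbit segments of uniformly bounded length of a totally irrational rotation visit a given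
nonempty open set. -/
lemma TotallyIrrational.exists_visit_time {ω : Torus d} (hω : TotallyIrrational ω)
    {U : Set (Torus d)} (hU : IsOpen U) (hne : U.Nonempty) :
    ∃ N : ℕ, ∀ θ : Torus d, ∃ n ≤ N, θ + n • ω ∈ U := by
  have hdense : ∀ θ : Torus d, ∃ n : ℕ, θ + n • ω ∈ U := by
    intro θ
    obtain ⟨u, hu⟩ := hne
    exact exists_nsmul_add_mem (WithLp.ofLp ω) hω
      (hU.preimage (PiLp.continuous_toLp 2 (fun _ : Fin d => UnitAddCircle)))
      ⟨WithLp.ofLp u, hu⟩ (WithLp.ofLp θ)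
  have : CompactSpace (Torus d) :=
    (PiLp.homeomorph 2 (fun _ : Fin d => UnitAddCircle)).symm.compactSpace
  obtain ⟨s, hs⟩ := isCompact_univ.elim_finite_subcover
    (fun n : ℕ => {θ : Torus d | θ + n • ω ∈ U})
    (fun n => hU.preimage (continuous_id.add continuous_const))
    (fun θ _ => Set.mem_iUnion.2 (hdense θ))
  refine ⟨s.sup id, fun θ => ?_⟩
  obtain ⟨n, hn, hz⟩ := Set.mem_iUnion₂.1 (hs (Set.mem_univ θ))
  exact ⟨n, Finset.le_sup (f := id) hn, hz⟩

end Kronecker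

/-! ### Order and continuity properties of the fibre iterates. -/

section Fibres

variable {d : ℕ} {ω : Torus d} {X : Set ℝ} {f : Torus d → ℝ → ℝ} {P : Constants d}

/-- `f_θ^k(x)`, the second coordinate of `f^k(θ, x)`. -/
def fibreIter (ω : Torus d) (f : Torus d → ℝ → ℝ) (k : ℕ) (θ : Torus d) (x : ℝ) : ℝ :=
  ((skew ω f)^[k] (θ, x)).2

@[simp] lemma fibreIter_zero (θ : Torus d) (x : ℝ) : fibreIter ω f 0 θ x = x := rfl

lemma skew_iterate (k : ℕ) (θ : Torus d) (x : ℝ) :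
    (skew ω f)^[k] (θ, x) = (θ + k • ω, fibreIter ω f k θ x) := by
  induction k with
  | zero => simp
  | succ k ih =>
    refine Prod.ext ?_ rfl
    rw [Function.iterate_succ_apply', ih]
    simp [skew, succ_nsmul, add_assoc]

lemma fibreIter_succ (k : ℕ) (θ : Torus d) (x : ℝ) :
    fibreIter ω f (k + 1) θ x = f (θ + k • ω) (fibreIter ω f k θ x) := by
  conv_lhs => rw [fibreIter, Function.iterate_succ_apply', skew_iterate]
  rfl

lemma fibreIter_add (a k : ℕ) (θ : Torus d) (x : ℝ) :
    fibreIter ω f (a + k) θ x = fibreIter ω f k (θ + a • ω) (fibreIter ω f a θ x) := by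
  rw [fibreIter, add_comm, Function.iterate_add_apply, skew_iterate a]
  rfl

lemma IsForcedMap.fibreIter_mem (hF : IsForcedMap ω X f) (k : ℕ) (θ : Torus d) {x : ℝ}
    (hx : x ∈ X) : fibreIter ω f k θ x ∈ X := by
  induction k with
  | zero => simpa
  | succ k ih => rw [fibreIter_succ]; exact hF.mapsTo _ ih

lemma IsForcedMap.fibreIter_mono (hF : IsForcedMap ω X f) (k : ℕ) (θ : Torus d) {x y : ℝ}
    (hx : x ∈ X) (hy : y ∈ X) (hxy : x ≤ y) : fibreIter ω f k θ x ≤ fibreIter ω f k θ y := by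
  induction k with
  | zero => simpa
  | succ k ih =>
    rw [fibreIter_succ, fibreIter_succ]
    exact hF.monotone _ (hF.fibreIter_mem _ _ hx) (hF.fibreIter_mem _ _ hy) ih

lemma IsForcedMap.one_mem (hF : IsForcedMap ω X f) : (1 : ℝ) ∈ X := hF.unit_subset (by simp)

lemma IsForcedMap.zero_mem (hF : IsForcedMap ω X f) : (0 : ℝ) ∈ X := hF.unit_subset (by simp)

lemma MemV.fibreIter_one_le (hf : MemV ω X f P) (k : ℕ) (θ : Torus d) :
    fibreIter ω f k θ 1 ≤ 1 := by
  induction k with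
  | zero => simp
  | succ k ih =>
    rw [fibreIter_succ]
    exact (hf.forced.monotone _ (hf.forced.fibreIter_mem _ _ hf.forced.one_mem)
      hf.forced.one_mem ih).trans (hf.concave.map_one_le _)

/-- Upper boundary lines decrease when the number of iterates increases. -/
lemma MemV.fibreIter_one_add_le (hf : MemV ω X f P) (a k : ℕ) (θ : Torus d) :
    fibreIter ω f (a + k) θ 1 ≤ fibreIter ω f k (θ + a • ω) 1 := by
  rw [fibreIter_add]
  exact hf.forced.fibreIter_mono _ _ (hf.forced.fibreIter_mem _ _ hf.forced.one_mem)
    hf.forced.one_mem (hf.fibreIter_one_le _ _)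

/-- Strictness comes from the lower Lipschitz estimate: `f θ x = 0` would force `f θ 0 = 0` as well.
-/
lemma MemV.map_neg (hf : MemV ω X f P) (θ : Torus d) {x : ℝ} (hx : x ∈ X) (h : x < 0) :
    f θ x < 0 := by
  have h0 := hf.forced.zero_mem
  have h1 := hf.forced.monotone θ hx h0 h.le
  have h2 := hf.concave.map_zero_le θ
  refine lt_of_le_of_ne (h1.trans h2) fun heq => ?_
  have h3 := hf.estimates.lower θ x hx 0 h0
  have h4 : f θ 0 = 0 := by linarith
  rw [heq, h4, sub_zero, sub_zero, abs_zero] at h3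
  have : 0 < P.α ^ (-P.p) * |x| :=
    mul_pos (Real.rpow_pos_of_pos (by linarith [P.one_lt_α]) _) (abs_pos.2 h.ne)
  linarith

lemma MemV.fibreIter_neg (hf : MemV ω X f P) (k : ℕ) (θ : Torus d) {x : ℝ} (hx : x ∈ X)
    (h : x < 0) : fibreIter ω f k θ x < 0 := by
  induction k with
  | zero => simpa
  | succ k ih => rw [fibreIter_succ]; exact hf.map_neg _ (hf.forced.fibreIter_mem _ _ hx) ih

lemma MemV.continuous_fibreIter_one (hf : MemV ω X f P) (k : ℕ) :
    Continuous fun θ => fibreIter ω f k θ 1 := by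
  induction k with
  | zero => simpa using continuous_const
  | succ k ih =>
    rw [continuous_iff_continuousAt]
    intro θ
    rw [ContinuousAt, tendsto_iff_dist_tendsto_zero]
    have hlim : Tendsto (fun θ' => P.S * dist θ' θ + P.α ^ P.p *
        dist (fibreIter ω f k θ' 1) (fibreIter ω f k θ 1)) (𝓝 θ) (𝓝 0) := by
      have h1 : Tendsto (fun θ' => dist θ' θ) (𝓝 θ) (𝓝 0) :=
        tendsto_iff_dist_tendsto_zero.1 tendsto_id
      have h2 := tendsto_iff_dist_tendsto_zero.1 (ih.tendsto θ)
      simpa using (h1.const_mul P.S).add (h2.const_mul (P.α ^ P.p))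
    refine squeeze_zero (fun _ => dist_nonneg) (fun θ' => ?_) hlim
    have hm := fun θ => hf.forced.fibreIter_mem k θ hf.forced.one_mem
    have h1 := hf.estimates.base (θ' + k • ω) (θ + k • ω) _ (hm θ')
    have h2 := hf.estimates.upper (θ + k • ω) _ (hm θ') _ (hm θ)
    rw [dist_add_right] at h1
    rw [fibreIter_succ, fibreIter_succ, Real.dist_eq, Real.dist_eq]
    exact (abs_sub_le _ (f (θ + k • ω) (fibreIter ω f k θ' 1)) _).trans (add_le_add h1 h2)

end Fibres

/-! ### Critical regions, nonnegativity of the upper lines, and visits before bad times. -/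

section CriticalRegions

variable {d : ℕ} {ω : Torus d} {X : Set ℝ} {f : Torus d → ℝ → ℝ} {P : Constants d}

lemma mem_shift_iff (l : ℤ) (A : Set (Torus d)) (θ : Torus d) :
    θ ∈ shift ω l A ↔ θ - l • ω ∈ A := by
  constructor
  · rintro ⟨x, hx, rfl⟩
    simpa using hx
  · exact fun h => ⟨_, h, by simp⟩

namespace Constants

variable (P)

lemma one_le_K (n : ℕ) : 1 ≤ P.K n :=
  Nat.mul_pos P.K₀_pos (pow_pos (by linarith [P.two_le_κ]) n)

lemma M_le_M_succ (n : ℕ) : P.M n ≤ P.M (n + 1) :=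
  (Nat.le_mul_of_pos_left _ (P.one_le_K n)).trans (P.le_M n)

lemma M_monotone : Monotone P.M := monotone_nat_of_le_succ P.M_le_M_succ

lemma two_le_M (n : ℕ) : 2 ≤ P.M n := P.two_le_M_zero.trans (P.M_monotone n.zero_le)

lemma b_pos : 0 < P.b := (Real.sqrt_nonneg _).trans_lt P.b_large

/-- `K₀ = 1` would give `b_1 = 0`, hence `b = 0`. -/
lemma two_le_K₀ : 2 ≤ P.K₀ := by
  by_contra h
  have h1 : P.K₀ = 1 := by have := P.K₀_pos; omega
  have hz : ∀ n, bseq P.K₀ P.κ (n + 1) = 0 := by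
    intro n
    induction n with
    | zero => simp [bseq, Kseq, h1]
    | succ n ih => rw [bseq, ih, mul_zero]
  have := tendsto_nhds_unique ((tendsto_add_atTop_iff_nat 1).2 P.tendsto_b)
    (by simp only [hz]; exact tendsto_const_nhds)
  exact P.b_pos.ne' this

lemma two_pow_le_K (n : ℕ) : 2 ^ (n + 1) ≤ P.K n := by
  rw [pow_succ, mul_comm]
  exact Nat.mul_le_mul P.two_le_K₀ (Nat.pow_le_pow_left P.two_le_κ n)

lemma two_le_K (n : ℕ) : 2 ≤ P.K n :=
  (Nat.le_self_pow n.succ_ne_zero 2).trans (P.two_pow_le_K n)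

lemma two_mul_K_le (n : ℕ) : 2 * P.K n ≤ P.K (n + 1) := by
  have := Nat.mul_le_mul_left (P.K n) P.two_le_κ
  simp only [K, Kseq] at this ⊢
  rw [pow_succ, ← mul_assoc]
  linarith

lemma K_monotone : Monotone P.K :=
  monotone_nat_of_le_succ fun n => by have := P.two_mul_K_le n; omega

lemma two_mul_M_le (n : ℕ) : 2 * P.M n ≤ P.M (n + 1) :=
  (Nat.mul_le_mul_right _ (P.two_le_K n)).trans (P.le_M n)

lemma add_two_le_M (n : ℕ) : n + 2 ≤ P.M n := by
  induction n with
  | zero => exact P.two_le_M_zero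
  | succ n ih => have := P.two_mul_M_le n; omega

end Constants

/-- The `M_n - 1` steps from `C` and the `M_n + 1` steps into `E` form one orbit segment of length
`2 M_n`. -/
lemma mem_critRegion_succ_iff (n : ℕ) (θ : Torus d) :
    θ ∈ critRegion ω f P (n + 1) ↔ θ ∈ critRegion ω f P n ∧
      ∃ x ∈ P.C, fibreIter ω f (2 * P.M n) (θ - (P.M n - 1) • ω) x ∈ P.E := by
  obtain ⟨m, hm⟩ : ∃ m, P.M n = m + 1 := ⟨P.M n - 1, by have := P.two_le_M n; omega⟩
  simp only [critRegion, hm, Nat.add_sub_cancel, Nat.cast_add, Nat.cast_one,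
    add_sub_cancel_right]
  have h2 : 2 * (m + 1) = m + (m + 1 + 1) := by ring
  constructor
  · rintro ⟨z, ⟨⟨⟨θ', x⟩, ⟨hθ', hx⟩, hz⟩, hz2⟩, rfl⟩
    rw [mem_shift_iff] at hθ'
    beta_reduce at hz
    rw [skew_iterate] at hz
    subst hz
    simp only [Set.mem_preimage, skew_iterate] at hz2
    refine ⟨by simpa using hθ', x, hx, ?_⟩
    simpa [h2, fibreIter_add] using hz2.2
  · rintro ⟨hθ, x, hx, hE⟩
    refine ⟨_, ⟨⟨(θ - m • ω, x), ⟨?_, hx⟩, rfl⟩, ?_⟩, ?_⟩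
    · simpa [mem_shift_iff] using hθ
    · rw [h2, fibreIter_add] at hE
      simp only [Set.mem_preimage, skew_iterate]
      refine ⟨?_, hE⟩
      rw [mem_shift_iff]
      have : ((m : ℤ) + 1 + 1) • ω = (m + 1 + 1) • ω := by
        rw [← natCast_zsmul]; push_cast; rfl
      simpa [this] using hθ
    · simp [skew_iterate]

lemma critRegion_antitone : Antitone (critRegion ω f P) :=
  antitone_nat_of_succ_le fun n _ h => ((mem_critRegion_succ_iff n _).1 h).1

/-- Upper boundary lines are nonnegative. -/
lemma MemV.fibreIter_one_nonneg (hf : MemV ω X f P) (m : ℕ) (θ : Torus d) :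
    0 ≤ fibreIter ω f m θ 1 := by
  by_contra! hneg
  have hX := hf.forced.one_mem
  -- `N` must be uniform in the starting point: the level `N + m + 1`, and with it the segment from
  -- `C` to `E`, is chosen afterwards. That segment is long enough to become negative, and then
  -- cannot end in `E`.
  obtain ⟨N, hN⟩ := hf.forced.irrational.exists_visit_time
    (U := {θ | fibreIter ω f m θ 1 < 0})
    (isOpen_lt (hf.continuous_fibreIter_one m) continuous_const) ⟨θ, hneg⟩
  obtain ⟨θ', hθ'⟩ := (hf.condF1 (N + m + 1) (by omega) (N + m + 1) le_rfl).1
  obtain ⟨-, x, hx, hE⟩ := (mem_critRegion_succ_iff _ _).1 hθ'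
  set M := P.M (N + m) with hM
  set θ₁ := θ' - (M - 1) • ω
  obtain ⟨k, hk, hk2⟩ := hN θ₁
  have hxX : x ∈ X := hf.forced.unit_subset
    ⟨(P.e_pos.trans P.e_lt_c).le.trans hx.1, hx.2⟩
  have h1 : fibreIter ω f (k + m) θ₁ 1 < 0 := (hf.fibreIter_one_add_le k m θ₁).trans_lt hk2
  have hle : k + m ≤ 2 * M := by have := P.add_two_le_M (N + m); omega
  obtain ⟨r, hr⟩ := Nat.exists_eq_add_of_le hle
  have h2 : fibreIter ω f (2 * M) θ₁ 1 < 0 := by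
    rw [hr, fibreIter_add]
    exact hf.fibreIter_neg _ _ (hf.forced.fibreIter_mem _ _ hX) h1
  have h3 := hf.forced.fibreIter_mono (2 * M) θ₁ hxX hX hx.2
  exact absurd hE.1 (not_le.2 (h3.trans_lt h2))

/-- An earlier return would put a common point in the two sets of the first condition, making their
distance 0. -/
lemma MemV.two_mul_lt_of_mem (hf : MemV ω X f P) {θ : Torus d} {j : ℕ} {a b : ℤ}
    (ha : θ + a • ω ∈ critRegion ω f P j) (hb : θ + b • ω ∈ critRegion ω f P j) (hab : a < b) :
    2 * (P.K j : ℤ) * P.M j < b - a := by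
  by_contra! h
  have h1 := (hf.condF1 (j + 1) (by omega) j (by omega)).2
  have h0 : 0 < P.eps j :=
    mul_pos P.c₀_pos (Real.rpow_pos_of_pos (by linarith [P.one_lt_α]) _)
  refine absurd (h0.trans h1) (not_lt.2 (csInf_le ?_ ?_))
  · refine ⟨0, ?_⟩
    rintro r ⟨x, -, y, -, rfl⟩
    exact dist_nonneg
  · refine ⟨_, hb, θ + b • ω, ⟨(b - a).toNat, by omega, ?_, ?_⟩, (dist_self _).symm⟩
    · zify; omega
    · rw [mem_shift_iff, Int.toNat_of_nonneg (by omega)]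
      convert ha using 1
      module

/-- The second condition in terms of visit times `a` and `b` along one orbit. -/
lemma MemV.notMem_of_mem (hf : MemV ω X f P) {θ : Torus d} {i j : ℕ} {a s b : ℤ}
    (ha : θ + a • ω ∈ critRegion ω f P i) (hs : s = -((P.M i : ℤ) - 1) ∨ s = (P.M i : ℤ) + 1)
    (hj : j < i) (h1 : -((P.M j : ℤ) - 1) ≤ a + s - b) (h2 : a + s - b ≤ (P.M j : ℤ) + 1) :
    θ + b • ω ∉ critRegion ω f P j := by
  intro hb
  have h := (hf.condF2 (i + 1) (by omega) i (by omega)).2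
  have hmem : θ + (a + s) • ω ∈ shift ω s (critRegion ω f P i) := by
    rw [mem_shift_iff]
    convert ha using 1
    module
  have hmem2 : θ + (a + s) • ω ∈ shift ω (a + s - b) (critRegion ω f P j) := by
    rw [mem_shift_iff]
    convert hb using 1
    module
  refine Set.eq_empty_iff_forall_notMem.1 h (θ + (a + s) • ω) ⟨?_, ?_⟩
  · rcases hs with rfl | rfl
    · exact Or.inl hmem
    · exact Or.inr hmem
  · rcases le_or_gt 1 (a + s - b) with h3 | h3
    · exact Or.inl ⟨j, hj, _, h3, h2, hmem2⟩
    · exact Or.inr ⟨j, hj, _, h1, by omega, hmem2⟩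

/-- Points of the upper boundary lines outside `C` have recently visited a critical region. -/
lemma MemV.exists_visit_of_fibreIter_lt (hf : MemV ω X f P) (θ : Torus d) (k : ℕ) (m : ℤ)
    (h : fibreIter ω f k (θ + m • ω) 1 < P.c) :
    ∃ i l : ℕ, 1 ≤ l ∧ l ≤ k ∧ l ≤ P.M i + 1 ∧ θ + (m + k - l) • ω ∈ critRegion ω f P i := by
  induction k using Nat.strong_induction_on generalizing m with
  | _ k ih =>
  have hc1 := P.c_lt_one
  obtain _ | k := k
  · simp at h
    linarith
  by_contra! hcon
  have hI0 : θ + (m + k) • ω ∉ P.I₀ := by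
    have := hcon 0 1 le_rfl (by omega) (by omega)
    simpa [critRegion, ← add_assoc] using this
  have hup := hf.fibreIter_one_le k (θ + m • ω)
  have hlt : fibreIter ω f k (θ + m • ω) 1 < P.e := by
    by_contra! he
    have := (hf.estimates.mem_C _ hI0 _ ⟨he, hup⟩).1
    rw [add_smul, natCast_zsmul, ← add_assoc, ← fibreIter_succ (f := f)] at this
    linarith
  obtain ⟨j, l, hl1, hlk, hlM, hl⟩ := ih k k.lt_succ_self m (hlt.trans P.e_lt_c)
  -- Any smaller `l` would still count as a recent visit one step later.
  have hlM' : l = P.M j + 1 := by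
    by_contra hne
    refine hcon j (l + 1) (by omega) (by omega) (by omega) ?_
    convert hl using 3
    push_cast; ring
  have hnext : θ + (m + k - l) • ω ∉ critRegion ω f P (j + 1) := by
    have := hcon (j + 1) (l + 1) (by omega) (by omega)
      (by have := P.two_mul_M_le j; have := P.two_le_M j; omega)
    convert this using 4
    push_cast; ring
  have hMj := P.two_le_M j
  have hstart : (θ + (m + k - l) • ω) - (P.M j - 1) • ω = θ + (m + k - 2 * P.M j) • ω := by
    rw [← natCast_zsmul, Nat.cast_sub (by omega), hlM']
    push_cast
    module
  -- no point of `C` is mapped into `E`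
  have hE : ∀ x ∈ P.C, fibreIter ω f (2 * P.M j) (θ + (m + k - 2 * P.M j) • ω) x ∉ P.E := by
    intro x hx hxE
    refine hnext ((mem_critRegion_succ_iff _ _).2 ⟨hl, x, hx, ?_⟩)
    rwa [hstart]
  rcases le_total (2 * P.M j) k with hk | hk
  · obtain ⟨r, rfl⟩ := Nat.exists_eq_add_of_le' hk
    have heq : fibreIter ω f (r + 2 * P.M j) (θ + m • ω) 1 = fibreIter ω f (2 * P.M j)
        (θ + (m + ↑(r + 2 * P.M j) - 2 * P.M j) • ω) (fibreIter ω f r (θ + m • ω) 1) := by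
      rw [fibreIter_add, ← natCast_zsmul]
      congr 1
      push_cast
      module
    -- The point at time `r = k - 2 M_j` is thus bad too, and the visit preceding it contradicts
    -- non-recurrence whatever its level `i`.
    have hrC : fibreIter ω f r (θ + m • ω) 1 < P.c := by
      by_contra! hge
      refine hE _ ⟨hge, hf.fibreIter_one_le _ _⟩ ?_
      rw [← heq]
      exact ⟨hf.fibreIter_one_nonneg _ _, hlt.le⟩
    obtain ⟨i, l', h1, h2, h3, h4⟩ := ih r (by omega) m hrC
    have hKj : (P.M j : ℤ) ≤ P.K j * P.M j := by
      exact_mod_cast Nat.le_mul_of_pos_left _ (P.one_le_K j)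
    rcases lt_trichotomy i j with hij | rfl | hij
    · refine hf.notMem_of_mem hl (Or.inl rfl) hij ?_ ?_ h4 <;> push_cast <;> omega
    · have := hf.two_mul_lt_of_mem h4 hl (by push_cast; omega)
      rw [mul_assoc] at this
      push_cast at this
      omega
    · have hfar : (P.M i : ℤ) + 1 < l' + 2 * P.M j + 1 := by
        by_contra! hle
        refine hcon i (l' + 2 * P.M j + 1) (by omega) (by omega) (by omega) ?_
        convert h4 using 3
        push_cast; ring
      refine hf.notMem_of_mem h4 (Or.inr rfl) hij ?_ ?_ hl <;> push_cast <;> omega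
  -- The segment starts before time 0; starting earlier at height 1 only lowers the endpoint.
  · refine hE 1 ⟨hc1.le, le_rfl⟩ ⟨hf.fibreIter_one_nonneg _ _, ?_⟩
    obtain ⟨r, hr⟩ := Nat.exists_eq_add_of_le' hk
    rw [hr]
    refine (hf.fibreIter_one_add_le r k _).trans (le_trans (le_of_eq ?_) hlt.le)
    congr 1
    rw [← natCast_zsmul]
    have : (2 * (P.M j : ℤ)) = r + k := by exact_mod_cast hr
    rw [this]
    module

end CriticalRegions

/-! ### Density of times close to visits, and its comparison with `1 - b`. -/

section Counting

lemma card_mul_le_of_spaced {A : Finset ℕ} {G lo W : ℕ} (hG : 0 < G)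
    (hA : ∀ a ∈ A, lo ≤ a ∧ a ≤ lo + W) (hgap : ∀ a ∈ A, ∀ b ∈ A, a < b → G ≤ b - a) :
    A.card * G ≤ W + G := by
  have hcard : A.card ≤ (Finset.range (W / G + 1)).card := by
    have key : ∀ a ∈ A, ∀ b ∈ A, a < b → (a - lo) / G ≠ (b - lo) / G := by
      intro a ha b hb hab h
      have h1 := hgap a ha b hb hab
      have h2 : b - lo = (a - lo) + G + (b - a - G) := by have := (hA a ha).1; omega
      have h3 : (a - lo + G) / G ≤ (b - lo) / G := Nat.div_le_div_right (by omega)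
      rw [Nat.add_div_right _ hG] at h3
      omega
    refine Finset.card_le_card_of_injOn (fun a => (a - lo) / G) (fun a ha => ?_) ?_
    · have := (hA a ha).2
      simp only [Finset.coe_range, Set.mem_Iio, Nat.lt_succ_iff]
      exact Nat.div_le_div_right (by omega)
    · intro a ha b hb h
      rcases lt_trichotomy a b with hab | hab | hab
      · exact absurd h (key a ha b hb hab)
      · exact hab
      · exact absurd h.symm (key b hb a ha hab)
  rw [Finset.card_range] at hcard
  calc A.card * G ≤ (W / G + 1) * G := Nat.mul_le_mul_right _ hcard
    _ = W / G * G + G := by ring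
    _ ≤ W + G := Nat.add_le_add_right (Nat.div_mul_le_self _ _) _

namespace Constants

variable {d : ℕ} (P : Constants d)

lemma sum_one_div_K_le {a b : ℕ} (hab : a ≤ b) :
    ∑ i ∈ Finset.Ico a b, 1 / (P.K i : ℝ) ≤ 2 / P.K a - 2 / P.K b := by
  induction b, hab using Nat.le_induction with
  | base => simp
  | succ b hab ih =>
    rw [Finset.sum_Ico_succ_top hab]
    have h0 : (0 : ℝ) < P.K b := by exact_mod_cast P.one_le_K b
    have h1 : (2 : ℝ) * P.K b ≤ P.K (b + 1) := by exact_mod_cast P.two_mul_K_le b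
    have h2 : (2 : ℝ) / P.K (b + 1) ≤ 1 / P.K b := by
      rw [div_le_div_iff₀ (by linarith) h0]
      linarith
    have h3 : (2 : ℝ) / P.K b = 1 / P.K b + 1 / P.K b := by ring
    linarith

lemma sum_M_le (J : ℕ) : ∑ i ∈ Finset.range (J + 1), P.M i ≤ 2 * P.M J := by
  induction J with
  | zero => simp; omega
  | succ J ih =>
    rw [Finset.sum_range_succ]
    have := P.two_mul_M_le J
    omega

/-- The number of times shortly after a visit, for visits spaced by more than `2 K_i M_i`. -/
lemma card_near_visits_le {V : ℕ → ℕ → Prop}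
    (hgap : ∀ i a b, V i a → V i b → a < b → 2 * P.K i * P.M i < b - a)
    {J m n : ℕ} (hmn : m ≤ n)
    (hlate : ∀ i, J < i → ∀ a, a + P.M J ≤ n → V i a → a + 2 * P.K i * P.M i < n)
    {B : Finset ℕ}
    (hB : ∀ k ∈ B, m ≤ k ∧ k < n ∧ ∃ i a, a < k ∧ k ≤ a + P.M i + 1 ∧ V i a) :
    (B.card : ℝ) ≤ ((n : ℝ) - m) *
      (3 / 4 * ∑ i ∈ Finset.range (J + 1), 1 / (P.K i : ℝ) + 3 / P.K (J + 1)) + 7 * P.M J := by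
  classical
  -- Visits up to `M_i + 1` before `m` still affect the window.
  set A : ℕ → Finset ℕ := fun i =>
    (Finset.Ico (m - (P.M i + 1)) n).filter
      (fun a => V i a ∧ (J < i → a + 2 * P.K i * P.M i < n)) with hA
  set N : ℕ → Finset ℕ := fun i => (A i).biUnion fun a => Finset.Ioc a (a + P.M i + 1) with hN
  have hD : (0 : ℝ) ≤ (n : ℝ) - m := by
    have : (m : ℝ) ≤ n := by exact_mod_cast hmn
    linarith
  have hNcard : ∀ i, (N i).card ≤ (A i).card * (P.M i + 1) := fun i => by
    refine Finset.card_biUnion_le_card_mul _ _ _ fun a _ => ?_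
    simp
    omega
  have hG : ∀ i, 0 < 2 * P.K i * P.M i := fun i =>
    Nat.mul_pos (Nat.mul_pos two_pos (P.one_le_K i)) (by have := P.two_le_M i; omega)
  have hspaced : ∀ i, ∀ a ∈ A i, ∀ b ∈ A i, a < b → 2 * P.K i * P.M i ≤ b - a := by
    intro i a ha b hb hab
    simp only [hA, Finset.mem_filter] at ha hb
    exact (hgap i a b ha.2.1 hb.2.1 hab).le
  have hcov : B ⊆ ((Finset.range (J + 1)).biUnion N ∪ (Finset.Ico (J + 1) (J + 1 + n)).biUnion N) ∪
      Finset.Ico (n - P.M J) n := by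
    intro k hk
    obtain ⟨hmk, hkn, i, a, hak, hka, hV⟩ := hB k hk
    by_cases hiJ : i ≤ J
    · refine Finset.mem_union_left _ (Finset.mem_union_left _ (Finset.mem_biUnion.2
        ⟨i, by simp; omega, Finset.mem_biUnion.2 ⟨a, ?_, by simp; omega⟩⟩))
      simp only [hA, Finset.mem_filter, Finset.mem_Ico]
      exact ⟨by omega, hV, by omega⟩
    · by_cases ha : a + P.M J ≤ n
      · have hl := hlate i (by omega) a ha hV
        have hi : i < n := by
          have h1 := P.add_two_le_M i
          have h2 := Nat.le_mul_of_pos_left (P.M i) (Nat.mul_pos two_pos (P.one_le_K i))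
          change P.M i ≤ 2 * P.K i * P.M i at h2
          omega
        refine Finset.mem_union_left _ (Finset.mem_union_right _ (Finset.mem_biUnion.2
          ⟨i, by simp; omega, Finset.mem_biUnion.2 ⟨a, ?_, by simp; omega⟩⟩))
        simp only [hA, Finset.mem_filter, Finset.mem_Ico]
        exact ⟨by omega, hV, fun _ => hl⟩
      · exact Finset.mem_union_right _ (by simp; omega)
  have hcast : ∀ i, ((P.M i : ℝ) + 1 ≤ 3 / 2 * P.M i) ∧ (2 : ℝ) ≤ P.M i ∧ (2 : ℝ) ≤ P.K i := by
    intro i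
    have h1 : (2 : ℝ) ≤ P.M i := by exact_mod_cast P.two_le_M i
    have h2 : (2 : ℝ) ≤ P.K i := by exact_mod_cast P.two_le_K i
    exact ⟨by linarith, h1, h2⟩
  have hearly : ∀ i, ((N i).card : ℝ) ≤
      ((n : ℝ) - m) * (3 / 4 * (1 / (P.K i : ℝ))) + 3 * P.M i := by
    intro i
    obtain ⟨h1, h2, h3⟩ := hcast i
    have hc := card_mul_le_of_spaced (A := A i) (lo := m - (P.M i + 1))
      (W := n - m + P.M i + 1) (hG i)
      (fun a ha => by
        simp only [hA, Finset.mem_filter, Finset.mem_Ico] at ha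
        omega) (hspaced i)
    have hc' : ((A i).card : ℝ) * (2 * P.K i * P.M i) ≤
        ((n : ℝ) - m) + P.M i + 1 + 2 * P.K i * P.M i := by
      rw [← Nat.cast_sub hmn]; exact_mod_cast hc
    have hKM : 2 * (P.M i : ℝ) ≤ P.K i * P.M i := by gcongr
    have h5 : ((A i).card : ℝ) ≤ (((n : ℝ) - m) + 3 / 2 * P.M i + 2 * P.K i * P.M i) /
        (2 * P.K i * P.M i) := by
      rw [le_div_iff₀ (by positivity)]
      linarith
    calc ((N i).card : ℝ) ≤ (A i).card * (P.M i + 1) := by exact_mod_cast hNcard i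
      _ ≤ (((n : ℝ) - m) + 3 / 2 * P.M i + 2 * P.K i * P.M i) /
        (2 * P.K i * P.M i) * (3 / 2 * P.M i) := by gcongr
      _ = ((n : ℝ) - m) * (3 / 4 * (1 / (P.K i : ℝ))) + (9 / 8 * (1 / P.K i) + 3 / 2) * P.M i := by
        field_simp
        ring
      _ ≤ _ := by
        have : 1 / (P.K i : ℝ) ≤ 1 / 2 := one_div_le_one_div_of_le (by norm_num) h3
        gcongr
        linarith
  have hlater : ∀ i ∈ Finset.Ico (J + 1) (J + 1 + n), ((N i).card : ℝ) ≤
      ((n : ℝ) - m) * (3 / 2) * (1 / (P.K i : ℝ)) := by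
    intro i hi
    obtain ⟨h1, h2, h3⟩ := hcast i
    have hiJ : J < i := by simp at hi; omega
    rcases (A i).eq_empty_or_nonempty with h0 | ⟨a₀, ha₀⟩
    · simp only [hN, h0, Finset.biUnion_empty, Finset.card_empty, Nat.cast_zero]
      positivity
    simp only [hA, Finset.mem_filter, Finset.mem_Ico] at ha₀
    have hlast := ha₀.2.2 hiJ
    -- Visits stop `2 K_i M_i` before `n`; this shortening cancels the extra gap in the spacing
    -- bound, so no boundary term remains.
    have hc := card_mul_le_of_spaced (A := A i) (lo := m - (P.M i + 1))
      (W := n - (m - (P.M i + 1)) - 2 * P.K i * P.M i) (hG i)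
      (fun a ha => by
        simp only [hA, Finset.mem_filter, Finset.mem_Ico] at ha
        have := ha.2.2 hiJ
        omega) (hspaced i)
    have hKM : 2 * P.M i ≤ P.K i * P.M i := Nat.mul_le_mul_right _ (P.two_le_K i)
    have hM := P.two_le_M i
    rw [mul_assoc] at hlast hc
    have hc2 : (A i).card * (2 * (P.K i * P.M i)) ≤ 2 * (n - m) := by omega
    have hc' : ((A i).card : ℝ) * (2 * (P.K i * P.M i)) ≤ 2 * ((n : ℝ) - m) := by
      rw [← Nat.cast_sub hmn]; exact_mod_cast hc2
    have h5 : ((A i).card : ℝ) ≤ ((n : ℝ) - m) / (P.K i * P.M i) := by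
      rw [le_div_iff₀ (by positivity)]
      linarith
    calc ((N i).card : ℝ) ≤ (A i).card * (P.M i + 1) := by exact_mod_cast hNcard i
      _ ≤ ((n : ℝ) - m) / (P.K i * P.M i) * (3 / 2 * P.M i) := by gcongr
      _ = _ := by field_simp
  have hcardB : (B.card : ℝ) ≤ ∑ i ∈ Finset.range (J + 1), ((N i).card : ℝ) +
      ∑ i ∈ Finset.Ico (J + 1) (J + 1 + n), ((N i).card : ℝ) + P.M J := by
    have h1 := (Finset.card_le_card hcov).trans (Finset.card_union_le _ _)
    have h2 := Finset.card_union_le ((Finset.range (J + 1)).biUnion N)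
      ((Finset.Ico (J + 1) (J + 1 + n)).biUnion N)
    have h3 := Finset.card_biUnion_le (s := Finset.range (J + 1)) (t := N)
    have h4 := Finset.card_biUnion_le (s := Finset.Ico (J + 1) (J + 1 + n)) (t := N)
    have h5 : (Finset.Ico (n - P.M J) n).card ≤ P.M J := by simp; omega
    exact_mod_cast (by omega : B.card ≤ ∑ i ∈ Finset.range (J + 1), (N i).card +
      ∑ i ∈ Finset.Ico (J + 1) (J + 1 + n), (N i).card + P.M J)
  have hs1 := Finset.sum_le_sum fun i (_ : i ∈ Finset.range (J + 1)) => hearly i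
  have hs2 := Finset.sum_le_sum hlater
  rw [Finset.sum_add_distrib, ← Finset.mul_sum, ← Finset.mul_sum, ← Finset.mul_sum] at hs1
  rw [← Finset.mul_sum] at hs2
  have hs3 : (∑ i ∈ Finset.range (J + 1), (P.M i : ℝ)) ≤ 2 * P.M J := by
    exact_mod_cast P.sum_M_le J
  have hs4 : ∑ i ∈ Finset.Ico (J + 1) (J + 1 + n), 1 / (P.K i : ℝ) ≤ 2 / P.K (J + 1) := by
    have := P.sum_one_div_K_le (Nat.le_add_right (J + 1) n)
    have h0 : (0 : ℝ) ≤ 2 / P.K (J + 1 + n) := by positivity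
    linarith
  have hs5 := mul_le_mul_of_nonneg_left hs4 (by positivity : 0 ≤ ((n : ℝ) - m) * (3 / 2))
  have hs6 : ((n : ℝ) - m) * (3 / 2) * (2 / P.K (J + 1)) = ((n : ℝ) - m) * (3 / P.K (J + 1)) := by
    ring
  rw [mul_add]
  linarith

lemma bseq_nonneg (n : ℕ) : 0 ≤ bseq P.K₀ P.κ n := by
  induction n with
  | zero => simp [bseq]
  | succ n ih =>
    refine mul_nonneg (sub_nonneg.2 ?_) ih
    have : (1 : ℝ) ≤ Kseq P.K₀ P.κ n := by exact_mod_cast P.one_le_K n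
    exact (div_le_one₀ (by linarith)).2 this

lemma b_le_bseq (n : ℕ) : P.b ≤ bseq P.K₀ P.κ n := by
  refine Antitone.le_of_tendsto (antitone_nat_of_succ_le fun n => ?_) P.tendsto_b n
  have h : 0 ≤ 1 / (Kseq P.K₀ P.κ n : ℝ) := by positivity
  rw [bseq]
  nlinarith [P.bseq_nonneg n]

/-- Each step lowers `b_n` by `b_n / K_n ≥ b / K_n`; telescope. -/
lemma b_mul_sum_le (n : ℕ) : P.b * ∑ i ∈ Finset.range n, 1 / (P.K i : ℝ) ≤ 1 - P.b := by
  have key : bseq P.K₀ P.κ n ≤ 1 - P.b * ∑ i ∈ Finset.range n, 1 / (P.K i : ℝ) := by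
    induction n with
    | zero => simp [bseq]
    | succ n ih =>
      rw [bseq, Finset.sum_range_succ]
      have h : P.b * (1 / (P.K n : ℝ)) ≤ bseq P.K₀ P.κ n * (1 / (Kseq P.K₀ P.κ n : ℝ)) :=
        mul_le_mul_of_nonneg_right (P.b_le_bseq n) (by positivity)
      linarith
  linarith [P.b_le_bseq n]

lemma b_lt_one : P.b < 1 := by
  have h := P.b_le_bseq 1
  have h1 : (0 : ℝ) < 1 / Kseq P.K₀ P.κ 0 :=
    one_div_pos.2 (by exact_mod_cast P.one_le_K 0)
  simp only [bseq, mul_one] at h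
  linarith

lemma two_le_p_sq : 2 ≤ P.p ^ 2 := by
  have := pow_le_pow_left₀ (Real.sqrt_nonneg 2) P.sqrt_two_le_p 2
  rwa [Real.sq_sqrt (by norm_num)] at this

lemma p_pos : 0 < P.p := (Real.sqrt_pos.2 two_pos).trans_le P.sqrt_two_le_p

lemma four_fifths_le_b : 4 / 5 ≤ P.b := by
  refine le_trans ?_ P.b_large.le
  refine Real.le_sqrt_of_sq_le ?_
  have := P.two_le_p_sq
  rw [le_div_iff₀ (by linarith)]
  linarith

lemma one_sub_b_mul_lt : (1 - P.b) * (P.p ^ 2 + 2) < 1 := by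
  have h2 := P.two_le_p_sq
  have h : (P.p ^ 2 + 1) / (P.p ^ 2 + 2) < P.b := by
    refine lt_of_le_of_lt (Real.le_sqrt_of_sq_le ?_) P.b_large
    have h0 : 0 ≤ (P.p ^ 2 + 1) / (P.p ^ 2 + 2) := by positivity
    have h1 : (P.p ^ 2 + 1) / (P.p ^ 2 + 2) ≤ 1 := (div_le_one₀ (by linarith)).2 (by linarith)
    nlinarith
  rw [div_lt_iff₀ (by linarith)] at h
  linarith

lemma tendsto_K : Tendsto P.K atTop atTop :=
  tendsto_atTop_mono (fun n => (n.lt_two_pow_self.le.trans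
    (Nat.pow_le_pow_right two_pos n.le_succ)).trans (P.two_pow_le_K n)) tendsto_id

lemma tendsto_M : Tendsto P.M atTop atTop :=
  tendsto_atTop_mono (fun n => (Nat.le_add_right n 2).trans (P.add_two_le_M n)) tendsto_id

lemma eventually_density_le : ∀ᶠ J in atTop,
    3 / 4 * ∑ i ∈ Finset.range (J + 1), 1 / (P.K i : ℝ) + 3 / P.K (J + 1) + 7 / P.K J ≤
      1 - P.b := by
  have hb := P.b_lt_one
  have hK : Tendsto (fun J => (P.K J : ℝ)) atTop atTop :=
    tendsto_natCast_atTop_atTop.comp P.tendsto_K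
  -- Since `b ≥ 4 / 5`, the sum term is at most `3/4 * 5/4 = 15/16` of `1 - b`, leaving `1/16` for
  -- `10 / K_J`.
  filter_upwards [hK.eventually_ge_atTop (10 / ((1 - P.b) / 16))] with J hJ
  have h0 : (0 : ℝ) < P.K J := by exact_mod_cast P.one_le_K J
  have h1 : (P.K J : ℝ) ≤ P.K (J + 1) := by exact_mod_cast P.K_monotone J.le_succ
  have h2 : 3 / (P.K (J + 1) : ℝ) ≤ 3 / P.K J := by gcongr
  have h3 : 10 / (P.K J : ℝ) ≤ (1 - P.b) / 16 := by
    rw [div_le_iff₀ (by linarith)] at hJ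
    rw [div_le_iff₀ h0]
    linarith
  have h4 := P.b_mul_sum_le (J + 1)
  have h5 := P.four_fifths_le_b
  have h6 : 0 ≤ ∑ i ∈ Finset.range (J + 1), 1 / (P.K i : ℝ) :=
    Finset.sum_nonneg fun _ _ => by positivity
  have h7 := mul_le_mul_of_nonneg_right h5 h6
  have h8 : 3 / (P.K J : ℝ) + 7 / P.K J = 10 / P.K J := by ring
  linarith

end Constants

end Counting

/-! ### Bad times of orbits ending over `Ω_{J+1}^n`. -/

section BadTimes

variable {d : ℕ} {ω : Torus d} {X : Set ℝ} {f : Torus d → ℝ → ℝ} {P : Constants d}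

lemma add_lt_of_mem_Omega {J n : ℕ} {θ : Torus d} (hθ : θ ∈ Omega ω f P (J + 1) n)
    {i a : ℕ} (hi : J < i) (ha : a + P.M J ≤ n)
    (hV : θ - n • ω + a • ω ∈ critRegion ω f P i) : a + 2 * P.K i * P.M i < n := by
  have hmem : ∀ i, θ - n • ω + a • ω ∈ critRegion ω f P i →
      θ ∈ shift ω ((n - a : ℕ) : ℤ) (critRegion ω f P i) := by
    intro i hV
    rw [mem_shift_iff, Nat.cast_sub (by omega)]
    convert hV using 1
    module
  -- The excluded ranges of consecutive levels overlap because `M_{i+1} + 2 ≤ 2 K_i M_i`; as the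
  -- regions are nested, the exclusion passes from level to level.
  induction i, hi using Nat.le_induction with
  | base =>
    by_contra! hle
    simp only [Nat.succ_eq_add_one] at hle
    exact hθ ⟨J + 1, le_rfl, n - a, by simp only [Constants.Mpred]; omega,
      le_min (by omega) (by omega), hmem _ hV⟩
  | succ i hi ih =>
    have h1 := ih (critRegion_antitone i.le_succ hV)
    have h2 := P.M_le i
    change P.M (i + 1) + 2 ≤ 2 * P.K i * P.M i at h2
    by_contra! hle
    exact hθ ⟨i + 1, by omega, n - a, by
      simp only [Constants.Mpred]
      have := P.M_monotone i.le_succ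
      simp only [Nat.succ_eq_add_one] at this
      omega, le_min (by omega) (by omega), hmem _ hV⟩

/-- The times in `[m, n)` at which the orbit of `(θ, 1)` is not in `C`. -/
def badTimes (ω : Torus d) (f : Torus d → ℝ → ℝ) (P : Constants d) (θ : Torus d) (m n : ℕ) :
    Finset ℕ :=
  open Classical in (Finset.Ico m n).filter fun k => fibreIter ω f k θ 1 < P.c

lemma mem_badTimes {θ : Torus d} {m n k : ℕ} : k ∈ badTimes ω f P θ m n ↔
    (m ≤ k ∧ k < n) ∧ fibreIter ω f k θ 1 < P.c := by
  simp [badTimes]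

lemma MemV.eventually_card_badTimes_le (hf : MemV ω X f P) : ∀ᶠ J in atTop, ∀ n : ℕ,
    ∀ θ ∈ Omega ω f P (J + 1) n, ∀ m : ℕ, m + P.K J * P.M J ≤ n →
      ((badTimes ω f P (θ - n • ω) m n).card : ℝ) ≤ (1 - P.b) * ((n : ℝ) - m) := by
  filter_upwards [P.eventually_density_le] with J hJ n θ hθ m hmn
  have h := P.card_near_visits_le (m := m) (n := n) (J := J)
    (V := fun i a => θ - n • ω + a • ω ∈ critRegion ω f P i)
    (B := badTimes ω f P (θ - n • ω) m n)
    (fun i a b ha hb hab => by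
      have := hf.two_mul_lt_of_mem (a := a) (b := b) (by simpa using ha) (by simpa using hb)
        (by omega)
      zify [hab.le]
      exact this)
    (by omega) (fun i hi a ha hV => add_lt_of_mem_Omega hθ hi ha hV)
    (fun k hk => by
      obtain ⟨⟨h1, h2⟩, h3⟩ := mem_badTimes.1 hk
      obtain ⟨i, l, hl1, hlk, hlM, hl⟩ := hf.exists_visit_of_fibreIter_lt (θ - n • ω) k 0
        (by simpa using h3)
      refine ⟨h1, h2, i, k - l, by omega, by omega, ?_⟩
      convert hl using 2
      rw [← natCast_zsmul, Nat.cast_sub hlk, zero_add])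
  have hK : (0 : ℝ) < P.K J := by exact_mod_cast P.one_le_K J
  have hD : (P.K J : ℝ) * P.M J ≤ (n : ℝ) - m := by
    have : (m : ℝ) + P.K J * P.M J ≤ n := by exact_mod_cast hmn
    linarith
  have hM : (P.M J : ℝ) ≤ ((n : ℝ) - m) * (1 / P.K J) := by
    rw [mul_one_div, le_div_iff₀ hK]
    linarith
  have hD0 : 0 ≤ (n : ℝ) - m := le_trans (by positivity) hD
  have h2 := mul_le_mul_of_nonneg_left hJ hD0
  have h3 : ((n : ℝ) - m) * (7 / P.K J) = 7 * (((n : ℝ) - m) * (1 / P.K J)) := by ring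
  linarith

end BadTimes

/-! ### From the density of bad times to contraction and Lipschitz bounds. -/

section Contraction

/-- A discrete Gronwall inequality. -/
lemma le_prod_mul_add_sum_prod {D q : ℕ → ℝ} {s : ℝ} {m n : ℕ} (hmn : m ≤ n)
    (hq : ∀ k, 0 ≤ q k) (hD : ∀ k, m ≤ k → k < n → D (k + 1) ≤ s + q k * D k) :
    D n ≤ (∏ k ∈ Finset.Ico m n, q k) * D m +
      s * ∑ i ∈ Finset.Ico m n, ∏ k ∈ Finset.Ico (i + 1) n, q k := by
  induction n, hmn using Nat.le_induction with
  | base => simp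
  | succ n hmn ih =>
    have h1 := ih fun k hk hkn => hD k hk (by omega)
    have h2 := hD n hmn n.lt_succ_self
    have h3 : ∑ i ∈ Finset.Ico m (n + 1), ∏ k ∈ Finset.Ico (i + 1) (n + 1), q k =
        (∑ i ∈ Finset.Ico m n, ∏ k ∈ Finset.Ico (i + 1) n, q k) * q n + 1 := by
      rw [Finset.sum_Ico_succ_top hmn, Finset.sum_mul]
      congr 1
      · refine Finset.sum_congr rfl fun i hi => ?_
        rw [Finset.prod_Ico_succ_top (by simp at hi; omega)]
      · simp
    rw [h3, Finset.prod_Ico_succ_top hmn]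
    have h4 := mul_le_mul_of_nonneg_left h1 (hq n)
    nlinarith

variable {d : ℕ} {ω : Torus d} {X : Set ℝ} {f : Torus d → ℝ → ℝ} {P : Constants d}

/-- The Lipschitz constant of the fibre maps at times in the set `B` of bad times, respectively
off this set. -/
def rate (P : Constants d) (B : Set ℕ) (k : ℕ) : ℝ :=
  open Classical in if k ∈ B then P.α ^ P.p else P.α ^ (-2 / P.p)

lemma rate_nonneg (B : Set ℕ) (k : ℕ) : 0 ≤ rate P B k := by
  have := P.one_lt_α
  unfold rate
  split_ifs <;> positivity

lemma prod_rate_le {B : Set ℕ} {m n : ℕ} (hmn : m ≤ n) {S : Finset ℕ}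
    (hS : ∀ k, m ≤ k → k < n → k ∈ B → k ∈ S) {y : ℝ} (hy : (S.card : ℝ) ≤ y) :
    ∏ k ∈ Finset.Ico m n, rate P B k ≤
      P.α ^ (-(2 / P.p) * ((n : ℝ) - m) + (2 / P.p + P.p) * y) := by
  classical
  have hα : 0 < P.α := by linarith [P.one_lt_α]
  have hp := P.p_pos
  have key : ∏ k ∈ Finset.Ico m n, rate P B k =
      P.α ^ (-(2 / P.p) * ((n : ℝ) - m) +
        (2 / P.p + P.p) * ((Finset.Ico m n).filter (· ∈ B)).card) := by
    have h1 : ∀ k, rate P B k = P.α ^ (-(2 / P.p) + if k ∈ B then 2 / P.p + P.p else 0) := by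
      intro k
      unfold rate
      split_ifs
      · congr 1; ring
      · congr 1; ring
    rw [Finset.prod_congr rfl fun k _ => h1 k, ← Real.rpow_sum_of_pos hα,
      Finset.sum_add_distrib, Finset.sum_const, Nat.card_Ico, nsmul_eq_mul, Nat.cast_sub hmn,
      ← Finset.sum_filter, Finset.sum_const, nsmul_eq_mul]
    congr 1
    ring
  rw [key]
  refine Real.rpow_le_rpow_of_exponent_le P.one_lt_α.le ?_
  have hc : ((Finset.Ico m n).filter (· ∈ B)).card ≤ S.card :=
    Finset.card_le_card fun k hk => by
      simp only [Finset.mem_filter, Finset.mem_Ico] at hk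
      exact hS k hk.1.1 hk.1.2 hk.2
  have hc' : (((Finset.Ico m n).filter (· ∈ B)).card : ℝ) ≤ y :=
    le_trans (by exact_mod_cast hc) hy
  gcongr

lemma MemV.abs_sub_le_rate (hf : MemV ω X f P) {B : Set ℕ} {k : ℕ} (θ : Torus d) {x y : ℝ}
    (hx : x ∈ X) (hy : y ∈ X) (hx1 : x ≤ 1) (hy1 : y ≤ 1)
    (hB : k ∉ B → P.c ≤ x ∧ P.c ≤ y) : |f θ x - f θ y| ≤ rate P B k * |x - y| := by
  unfold rate
  split_ifs with h
  · exact hf.estimates.upper θ x hx y hy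
  · exact hf.estimates.contract θ x ⟨(hB h).1, hx1⟩ y ⟨(hB h).2, hy1⟩

lemma upperLine_eq (n : ℕ) (θ : Torus d) :
    upperLine ω f n θ = fibreIter ω f n (θ - n • ω) 1 := rfl

lemma MemV.upperLine_sub_le (hf : MemV ω X f P) {n : ℕ} (hn : 1 ≤ n) {θ : Torus d} {y : ℝ}
    (hy : ((badTimes ω f P (θ - n • ω) 1 n).card : ℝ) ≤ y) :
    |upperLine ω f n θ - upperLine ω f (n - 1) θ| ≤
      P.α ^ (-(2 / P.p) * ((n : ℝ) - 1) + (2 / P.p + P.p) * y) := by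
  set θ₀ := θ - n • ω with hθ₀
  have hθ₁ : θ - (n - 1) • ω = θ₀ + ω := by
    rw [hθ₀, ← natCast_zsmul, ← natCast_zsmul, Nat.cast_sub hn]
    push_cast
    module
  set B : Set ℕ := {k | fibreIter ω f k θ₀ 1 < P.c}
  have hX := hf.forced.one_mem
  -- The orbits are ordered, so when the lower one is in `C` both are.
  have hle : ∀ k, 1 ≤ k → fibreIter ω f k θ₀ 1 ≤ fibreIter ω f (k - 1) (θ₀ + ω) 1 := by
    intro k hk
    have := hf.fibreIter_one_add_le 1 (k - 1) θ₀
    rwa [one_smul, Nat.add_sub_cancel' hk] at this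
  have h := le_prod_mul_add_sum_prod (s := 0) hn (rate_nonneg (P := P) B)
    (D := fun k => |fibreIter ω f k θ₀ 1 - fibreIter ω f (k - 1) (θ₀ + ω) 1|)
    (fun k hk1 _ => by
      obtain ⟨k, rfl⟩ := Nat.exists_eq_add_of_le' hk1
      have h1 := fibreIter_succ (ω := ω) (f := f) (k + 1) θ₀ 1
      have h2 := fibreIter_succ (ω := ω) (f := f) k (θ₀ + ω) 1
      have h3 : θ₀ + ω + k • ω = θ₀ + (k + 1) • ω := by rw [succ_nsmul']; abel
      simp only [Nat.add_sub_cancel]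
      rw [h1, h2, h3, zero_add]
      refine hf.abs_sub_le_rate _ (hf.forced.fibreIter_mem _ _ hX)
        (hf.forced.fibreIter_mem _ _ hX) (hf.fibreIter_one_le _ _) (hf.fibreIter_one_le _ _)
        fun hk => ?_
      have hc : P.c ≤ fibreIter ω f (k + 1) θ₀ 1 := not_lt.1 hk
      exact ⟨hc, hc.trans (hle (k + 1) (by omega))⟩)
  have h1 : |fibreIter ω f 1 θ₀ 1 - fibreIter ω f (1 - 1) (θ₀ + ω) 1| ≤ 1 := by
    have h2 := hf.fibreIter_one_nonneg 1 θ₀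
    have h3 := hf.fibreIter_one_le 1 θ₀
    rw [Nat.sub_self, fibreIter_zero, abs_le]
    constructor <;> linarith
  have hprod := prod_rate_le (P := P) (B := B) hn (S := badTimes ω f P θ₀ 1 n)
    (fun k hk hkn hkB => mem_badTimes.2 ⟨⟨hk, hkn⟩, hkB⟩) hy
  rw [upperLine_eq, upperLine_eq, hθ₁]
  refine h.trans ?_
  rw [zero_mul, add_zero]
  refine (mul_le_of_le_one_right (Finset.prod_nonneg fun k _ => rate_nonneg _ _) h1).trans ?_
  simpa using hprod

lemma MemV.upperLine_lipschitz (hf : MemV ω X f P) {n : ℕ} {θ θ' : Torus d} {T μ : ℝ}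
    (hμ : 0 < μ) (hμ' : μ = 2 / P.p - (2 / P.p + P.p) * (2 * (1 - P.b)))
    (hθ : ∀ m, m ≤ n →
      ((badTimes ω f P (θ - n • ω) m n).card : ℝ) ≤ (1 - P.b) * ((n : ℝ) - m) + T)
    (hθ' : ∀ m, m ≤ n →
      ((badTimes ω f P (θ' - n • ω) m n).card : ℝ) ≤ (1 - P.b) * ((n : ℝ) - m) + T) :
    |upperLine ω f n θ - upperLine ω f n θ'| ≤
      P.S * (P.α ^ (2 * (2 / P.p + P.p) * T) * (1 - P.α ^ (-μ))⁻¹) * dist θ θ' := by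
  have hα : 0 < P.α := by linarith [P.one_lt_α]
  set θ₀ := θ - n • ω with hθ₀
  set θ₁ := θ' - n • ω with hθ₁
  have hdist : ∀ k : ℕ, dist (θ₀ + k • ω) (θ₁ + k • ω) = dist θ θ' := fun k => by
    rw [dist_add_right, hθ₀, hθ₁, dist_sub_right]
  set B : Set ℕ := {k | fibreIter ω f k θ₀ 1 < P.c ∨ fibreIter ω f k θ₁ 1 < P.c}
  have hX := hf.forced.one_mem
  have h := le_prod_mul_add_sum_prod (s := P.S * dist θ θ') n.zero_le (rate_nonneg (P := P) B)
    (D := fun k => |fibreIter ω f k θ₀ 1 - fibreIter ω f k θ₁ 1|)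
    (fun k _ _ => by
      simp only [fibreIter_succ]
      have hm0 := hf.forced.fibreIter_mem k θ₀ hX
      have hm1 := hf.forced.fibreIter_mem k θ₁ hX
      have h1 := hf.estimates.base (θ₀ + k • ω) (θ₁ + k • ω) _ hm1
      rw [hdist] at h1
      have h2 := hf.abs_sub_le_rate (B := B) (k := k) (θ₀ + k • ω) hm0 hm1
        (hf.fibreIter_one_le _ _) (hf.fibreIter_one_le _ _) fun hk => by
          simpa [B, not_or] using hk
      have h3 := abs_sub_le (f (θ₀ + k • ω) (fibreIter ω f k θ₀ 1))
        (f (θ₀ + k • ω) (fibreIter ω f k θ₁ 1)) (f (θ₁ + k • ω) (fibreIter ω f k θ₁ 1))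
      linarith)
  have hr0 : 0 ≤ P.α ^ (-μ) := by positivity
  have hr1 : P.α ^ (-μ) < 1 := Real.rpow_lt_one_of_one_lt_of_neg P.one_lt_α (by linarith)
  have hprod : ∀ i ∈ Finset.Ico 0 n, ∏ k ∈ Finset.Ico (i + 1) n, rate P B k ≤
      P.α ^ (2 * (2 / P.p + P.p) * T) * (P.α ^ (-μ)) ^ (n - 1 - i) := by
    intro i hi
    have hin : i + 1 ≤ n := by simp at hi; omega
    have hcard : ((badTimes ω f P θ₀ (i + 1) n ∪ badTimes ω f P θ₁ (i + 1) n).card : ℝ) ≤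
        2 * (1 - P.b) * ((n : ℝ) - (i + 1 : ℕ)) + 2 * T := by
      have h1 : ((badTimes ω f P θ₀ (i + 1) n ∪ badTimes ω f P θ₁ (i + 1) n).card : ℝ) ≤
          (badTimes ω f P θ₀ (i + 1) n).card + (badTimes ω f P θ₁ (i + 1) n).card := by
        exact_mod_cast Finset.card_union_le _ _
      linarith [hθ (i + 1) hin, hθ' (i + 1) hin]
    refine (prod_rate_le hin (fun k hk hkn hkB => ?_) hcard).trans (le_of_eq ?_)
    · rcases hkB with hk' | hk'
      · exact Finset.mem_union_left _ (mem_badTimes.2 ⟨⟨hk, hkn⟩, hk'⟩)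
      · exact Finset.mem_union_right _ (mem_badTimes.2 ⟨⟨hk, hkn⟩, hk'⟩)
    · rw [← Real.rpow_natCast, ← Real.rpow_mul hα.le, ← Real.rpow_add hα]
      congr 1
      rw [Nat.sub_sub, Nat.add_comm 1 i, Nat.cast_sub hin, hμ']
      ring
  have hsum : ∑ i ∈ Finset.Ico 0 n, ∏ k ∈ Finset.Ico (i + 1) n, rate P B k ≤
      P.α ^ (2 * (2 / P.p + P.p) * T) * (1 - P.α ^ (-μ))⁻¹ := by
    refine (Finset.sum_le_sum hprod).trans ?_
    rw [← Finset.mul_sum, ← Finset.range_eq_Ico,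
      Finset.sum_range_reflect (fun i => (P.α ^ (-μ)) ^ i) n]
    refine mul_le_mul_of_nonneg_left ?_ (by positivity)
    rw [← tsum_geometric_of_lt_one hr0 hr1]
    exact (summable_geometric_of_lt_one hr0 hr1).sum_le_tsum _ fun _ _ => by positivity
  rw [upperLine_eq, upperLine_eq]
  refine h.trans ?_
  simp only [fibreIter_zero, sub_self, abs_zero, mul_zero, zero_add]
  calc _ ≤ P.S * dist θ θ' * (P.α ^ (2 * (2 / P.p + P.p) * T) * (1 - P.α ^ (-μ))⁻¹) :=
        mul_le_mul_of_nonneg_left hsum (mul_nonneg P.S_pos.le dist_nonneg)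
    _ = _ := by ring

namespace Constants

variable (P)

lemma contraction_rate_pos : 0 < 2 / P.p - (2 / P.p + P.p) * (2 * (1 - P.b)) := by
  have hp := P.p_pos
  have h := P.one_sub_b_mul_lt
  have : 2 / P.p - (2 / P.p + P.p) * (2 * (1 - P.b)) =
      2 / P.p * (1 - (1 - P.b) * (P.p ^ 2 + 2)) := by
    field_simp
    ring
  rw [this]
  exact mul_pos (by positivity) (by linarith)

/-- Constants and the factor `c₀` are absorbed by powers of `ε_j`. -/
lemma eventually_le_eps_rpow (A Q : ℝ) (hQ : 0 ≤ Q) : ∀ᶠ J in atTop,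
    A * P.α ^ (Q * (P.K J * P.M J)) ≤
      P.eps (J + 1) ^ (-((1 + Q) * (4 * P.p / P.b)) * (P.K J : ℝ)) := by
  have hα := P.one_lt_α
  have hα0 : 0 < P.α := by linarith
  have hp := P.p_pos
  have hb := P.b_pos
  have hM : Tendsto (fun J => (P.M J : ℝ)) atTop atTop :=
    tendsto_natCast_atTop_atTop.comp P.tendsto_M
  have hpow : Tendsto (fun x : ℝ => P.α ^ x) atTop atTop := tendsto_rpow_atTop_of_base_gt_one P.α hα
  have hM2 : Tendsto (fun J => (P.M J : ℝ) * (P.b / (4 * P.p))) atTop atTop :=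
    hM.atTop_mul_const (by positivity)
  filter_upwards [(hpow.comp hM).eventually_ge_atTop A,
    (hpow.comp hM2).eventually_ge_atTop P.c₀] with J hA hc
  simp only [Function.comp] at hA hc
  have hK : (1 : ℝ) ≤ P.K J := by exact_mod_cast P.one_le_K J
  have hMn : (0 : ℝ) ≤ P.M J := Nat.cast_nonneg _
  have heps0 : 0 < P.eps (J + 1) := mul_pos P.c₀_pos (Real.rpow_pos_of_pos hα0 _)
  -- Half of the decay of `ε_{J+1}` is spent on absorbing `c₀`.
  have heps : P.eps (J + 1) ≤ P.α ^ (-((P.M J : ℝ) * (P.b / (4 * P.p)))) := by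
    calc P.eps (J + 1) ≤ P.α ^ ((P.M J : ℝ) * (P.b / (4 * P.p))) *
          P.α ^ (-((P.M J : ℝ) * P.b / (2 * P.p))) := by
          unfold eps Mpred
          gcongr
      _ = _ := by
          rw [← Real.rpow_add hα0]
          congr 1
          field_simp
          ring
  have hexp : -((1 + Q) * (4 * P.p / P.b)) * (P.K J : ℝ) ≤ 0 := by
    rw [neg_mul, neg_nonpos]
    positivity
  calc A * P.α ^ (Q * (P.K J * P.M J)) ≤
        P.α ^ ((P.K J : ℝ) * P.M J) * P.α ^ (Q * (P.K J * P.M J)) := by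
        gcongr
        refine hA.trans (Real.rpow_le_rpow_of_exponent_le hα.le ?_)
        exact le_mul_of_one_le_left hMn hK
    _ = (P.α ^ (-((P.M J : ℝ) * (P.b / (4 * P.p))))) ^
          (-((1 + Q) * (4 * P.p / P.b)) * (P.K J : ℝ)) := by
        rw [← Real.rpow_add hα0, ← Real.rpow_mul hα0.le]
        congr 1
        field_simp
    _ ≤ _ := Real.rpow_le_rpow_of_nonpos heps0 heps hexp

end Constants

end Contraction

end QpfSNA

end

/-! ### Choice of the constants and conclusion. -/

theorem proposition3p1 {d : ℕ} (ω : QpfSNA.Torus d) (X : Set ℝ) (f : QpfSNA.Torus d → ℝ → ℝ)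
    (P : QpfSNA.Constants d) (hf : QpfSNA.MemV ω X f P) :
    ∃ lam : ℝ, 0 < lam ∧ ∃ C : ℝ, 0 < C ∧ ∃ j₀ : ℕ, 1 ≤ j₀ ∧ ∀ j : ℕ, j₀ ≤ j →
      (∀ n : ℕ, 2 * (P.K (j - 1) : ℤ) * P.M (j - 1) - P.M (j - 1) - 1 < (n : ℤ) →
        ∀ θ ∈ QpfSNA.Omega ω f P j n,
          |QpfSNA.upperLine ω f n θ - QpfSNA.upperLine ω f (n - 1) θ|
            ≤ P.α ^ (-lam * ((n : ℝ) - 1))) ∧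
      (∃ L : ℝ, 0 ≤ L ∧ L ≤ P.eps j ^ (-C * (P.K (j - 1) : ℝ)) ∧
        ∀ n : ℕ, 1 ≤ n → ∀ θ ∈ QpfSNA.Omega ω f P j n, ∀ θ' ∈ QpfSNA.Omega ω f P j n,
          |QpfSNA.upperLine ω f n θ - QpfSNA.upperLine ω f n θ'| ≤ L * dist θ θ') := by
  have hp := P.p_pos
  have hα : 0 < P.α := by linarith [P.one_lt_α]
  have hb := P.b_pos
  have hb1 := P.b_lt_one
  have hμ := P.contraction_rate_pos
  set μ := 2 / P.p - (2 / P.p + P.p) * (2 * (1 - P.b)) with hμ'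
  have hlam : 0 < 2 / P.p - (2 / P.p + P.p) * (1 - P.b) := by
    have : 0 ≤ (2 / P.p + P.p) * (1 - P.b) := mul_nonneg (by positivity) (by linarith)
    linarith
  have hr1 : P.α ^ (-μ) < 1 :=
    Real.rpow_lt_one_of_one_lt_of_neg P.one_lt_α (by linarith)
  have hinv : 0 ≤ (1 - P.α ^ (-μ))⁻¹ := inv_nonneg.2 (by linarith)
  set Q := 2 * (2 / P.p + P.p) with hQ
  obtain ⟨J₀, hJ₀⟩ := Filter.eventually_atTop.1 (hf.eventually_card_badTimes_le.and
    (P.eventually_le_eps_rpow (P.S * (1 - P.α ^ (-μ))⁻¹) Q (by positivity)))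
  refine ⟨_, hlam, (1 + Q) * (4 * P.p / P.b), by positivity, J₀ + 1, by omega, fun j hj => ?_⟩
  obtain ⟨J, rfl⟩ : ∃ J, j = J + 1 := ⟨j - 1, by omega⟩
  obtain ⟨hcard, heps⟩ := hJ₀ J (by omega)
  rw [Nat.add_sub_cancel]
  refine ⟨fun n hn θ hθ => ?_, _, ?_, heps, fun n _ θ hθ θ' hθ' => ?_⟩
  · have hKM : 2 * P.M J ≤ P.K J * P.M J := Nat.mul_le_mul_right _ (P.two_le_K J)
    have hM := P.two_le_M J
    -- The threshold on `n` makes the window `[1, n)` long enough for the density bound.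
    have hn' : 1 + P.K J * P.M J ≤ n := by
      rw [mul_assoc] at hn
      zify at hKM hM ⊢
      omega
    refine (hf.upperLine_sub_le (by omega) (hcard n θ hθ 1 hn')).trans (le_of_eq ?_)
    congr 1
    push_cast
    ring
  · have := P.S_pos
    positivity
  -- Short windows are counted trivially, whence the additive `K_J M_J`.
  · have hbad : ∀ θ ∈ QpfSNA.Omega ω f P (J + 1) n, ∀ m, m ≤ n →
        ((QpfSNA.badTimes ω f P (θ - n • ω) m n).card : ℝ) ≤
          (1 - P.b) * ((n : ℝ) - m) + P.K J * P.M J := by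
      intro θ hθ m hm
      have hm' : (m : ℝ) ≤ n := by exact_mod_cast hm
      rcases le_or_gt (m + P.K J * P.M J) n with h | h
      · have := hcard n θ hθ m h
        have h0 : (0 : ℝ) ≤ P.K J * P.M J := by positivity
        linarith
      · have h1 : (QpfSNA.badTimes ω f P (θ - n • ω) m n).card ≤ P.K J * P.M J := by
          refine (Finset.card_filter_le _ _).trans ?_
          rw [Nat.card_Ico]
          omega
        have h2 : ((QpfSNA.badTimes ω f P (θ - n • ω) m n).card : ℝ) ≤ P.K J * P.M J := by
          exact_mod_cast h1
        have h3 : 0 ≤ (1 - P.b) * ((n : ℝ) - m) := mul_nonneg (by linarith) (by linarith)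
        linarith
    refine (hf.upperLine_lipschitz hμ hμ' (hbad θ hθ) (hbad θ' hθ')).trans (le_of_eq ?_)
    rw [hQ]
    ring
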